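/- Let $\mathbb{F}_q$ be a finite field with $q$ elements, let $G=\mathrm{GL}(2,q)$ be the group of invertible $2\times 2$ matrices over $\mathbb{F}_q$, and let $N=\mathrm{SL}(2,q)\le G$ be the subgroup of matrices of determinant $1$. For a finite group $K$, let $\mathrm{R}(K)$ (respectively $\mathrm{RO}(K)$) be the Grothendieck group of the commutative monoid, under direct sum, of isomorphism classes of finite-dimensional complex (respectively real) representations of $K$, and let $\mathrm{Ind}_{\mathbb{C}}:\mathrm{R}(N)\to\mathrm{R}(G)$ and $\mathrm{Ind}_{\mathbb{R}}:\mathrm{RO}(N)\to\mathrm{RO}(G)$ be the group homomorphisms given by inducing representations from $N$ to $G$. Then: 1. $\mathrm{Ind}_{\mathbb{C}}$ is injective if and only if $q$ is a power of $2$. 2. $\mathrm{Ind}_{\mathbb{R}}$ is injective if and only if $q$ is a power of $2$ or $q\equiv 3\pmod 4$. -/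

import Mathlib

universe u

noncomputable section

namespace RepGrp

open Representation

/-- A finite-dimensional `k`-linear representation of `G` (a finitely generated `kG`-module,
when `G` is finite). -/
abbrev FinRep (k : Type) [Field k] (G : Type u) [Group G] : Type (u + 1) :=
  {A : Rep.{u} k G // Module.Finite k A}

section Classes

variable (k : Type) [Field k] (G : Type u) [Group G]

/-- Isomorphism of representations, as an equivalence relation. -/
instance isoSetoid : Setoid (FinRep k G) where
  r A B := Nonempty (A.1.ρ.Equiv B.1.ρ)
  iseqv :=
    { refl := fun A => ⟨Representation.Equiv.refl A.1.ρ⟩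
      symm := fun ⟨e⟩ => ⟨e.symm⟩
      trans := fun ⟨e⟩ ⟨f⟩ => ⟨e.trans f⟩ }

/-- Isomorphism classes of finite-dimensional representations of `G` over `k`. -/
def RepClass : Type (u + 1) := Quotient (isoSetoid k G)

end Classes

section Monoid

variable {k : Type} [Field k] {G : Type u} [Group G]

/-- The direct sum of two representations. -/
def FinRep.sum (A B : FinRep k G) : FinRep k G :=
  ⟨Rep.of (A.1.ρ.prod B.1.ρ), by
    have := A.2
    have := B.2
    exact inferInstanceAs (Module.Finite k (A.1.V × B.1.V))⟩

/-- The zero representation. -/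
def FinRep.zero : FinRep k G :=
  ⟨Rep.of (Representation.trivial k G PUnit.{u + 1}),
    inferInstanceAs (Module.Finite k PUnit.{u + 1})⟩

instance : Zero (RepClass k G) := ⟨Quotient.mk _ FinRep.zero⟩

instance : Add (RepClass k G) :=
  ⟨Quotient.map₂ FinRep.sum (by
    rintro A A' ⟨e⟩ B B' ⟨f⟩
    refine ⟨Representation.Equiv.mk (e.toLinearEquiv.prodCongr f.toLinearEquiv) fun g => ?_⟩
    refine LinearMap.ext fun x => Prod.ext ?_ ?_
    · exact IntertwiningMap.isIntertwining _ _ e.toIntertwiningMap g x.1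
    · exact IntertwiningMap.isIntertwining _ _ f.toIntertwiningMap g x.2)⟩

/-- Isomorphism classes of representations form a commutative monoid under direct sum. -/
instance : AddCommMonoid (RepClass k G) where
  add_assoc := by
    rintro ⟨A⟩ ⟨B⟩ ⟨C⟩
    exact Quotient.sound ⟨Representation.Equiv.mk (LinearEquiv.prodAssoc k A.1.V B.1.V C.1.V) fun g => rfl⟩
  add_comm := by
    rintro ⟨A⟩ ⟨B⟩
    exact Quotient.sound ⟨Representation.Equiv.mk (LinearEquiv.prodComm k A.1.V B.1.V) fun g => rfl⟩
  zero_add := by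
    rintro ⟨A⟩
    exact Quotient.sound ⟨Representation.Equiv.mk (LinearEquiv.uniqueProd (R := k) (M := A.1.V)
      (M₂ := PUnit.{u + 1})) fun g => rfl⟩
  add_zero := by
    rintro ⟨A⟩
    exact Quotient.sound ⟨Representation.Equiv.mk (LinearEquiv.prodUnique (R := k) (M := A.1.V)
      (M₂ := PUnit.{u + 1})) fun g => rfl⟩
  nsmul := nsmulRec

end Monoid

/-- The representation group of `G` over `k`: the Grothendieck group of the monoid of isomorphism
classes of finite-dimensional representations under direct sum. -/
abbrev RepGroup (k : Type) [Field k] (G : Type u) [Group G] : Type (u + 1) :=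
  Algebra.GrothendieckAddGroup (RepClass k G)

/-- The complex representation group `R(G)`. -/
abbrev R (G : Type u) [Group G] : Type (u + 1) := RepGroup ℂ G

/-- The real representation group `RO(G)`. -/
abbrev RO (G : Type u) [Group G] : Type (u + 1) := RepGroup ℝ G

section Induction

variable {k : Type} [Field k] {H G : Type u} [Group H] [Group G] (φ : H →* G)

/-- Functoriality of induction. -/
def indHom {V W : Type u} [AddCommGroup V] [Module k V] [AddCommGroup W] [Module k W]
    {ρ : Representation k H V} {σ : Representation k H W} (f : ρ.IntertwiningMap σ) :
    (ρ.ind φ).IntertwiningMap (σ.ind φ) :=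
  (Rep.indMap φ (Rep.ofHom f)).hom

/-- Isomorphic representations have isomorphic induced representations. -/
def indEquiv {V W : Type u} [AddCommGroup V] [Module k V] [AddCommGroup W] [Module k W]
    {ρ : Representation k H V} {σ : Representation k H W} (e : ρ.Equiv σ) :
    (ρ.ind φ).Equiv (σ.ind φ) :=
  Representation.Equiv.mk
    (LinearEquiv.ofLinearMap (indHom φ e.toIntertwiningMap).toLinearMap
      (indHom φ e.symm.toIntertwiningMap).toLinearMap
      (IndV.hom_ext φ σ fun g => LinearMap.ext fun v =>
        congrArg (IndV.mk φ σ g) (e.apply_symm_apply v))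
      (IndV.hom_ext φ ρ fun g => LinearMap.ext fun v =>
        congrArg (IndV.mk φ ρ g) (e.symm_apply_apply v)))
    fun g => LinearMap.ext fun x => IntertwiningMap.isIntertwining _ _ (indHom φ e.toIntertwiningMap) g x

/-- Induction commutes with direct sums. -/
def indProdEquiv {V W : Type u} [AddCommGroup V] [Module k V] [AddCommGroup W] [Module k W]
    (ρ : Representation k H V) (σ : Representation k H W) :
    ((ρ.prod σ).ind φ).Equiv ((ρ.ind φ).prod (σ.ind φ)) :=
  Representation.Equiv.mk
    (LinearEquiv.ofLinearMap
      ((indHom φ (IntertwiningMap.fst k ρ σ)).toLinearMap.prod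
        (indHom φ (IntertwiningMap.snd k ρ σ)).toLinearMap)
      ((indHom φ (IntertwiningMap.inl k ρ σ)).toLinearMap.coprod
        (indHom φ (IntertwiningMap.inr k ρ σ)).toLinearMap)
      (by
        refine LinearMap.prod_ext (IndV.hom_ext φ ρ fun g => LinearMap.ext fun v => ?_)
          (IndV.hom_ext φ σ fun g => LinearMap.ext fun v => ?_)
        · exact Prod.ext rfl (map_zero (IndV.mk φ σ g))
        · exact Prod.ext (map_zero (IndV.mk φ ρ g)) rfl)
      (IndV.hom_ext φ _ fun g => LinearMap.ext fun v => by
        change IndV.mk φ (ρ.prod σ) g (v.1, 0) + IndV.mk φ (ρ.prod σ) g (0, v.2) =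
          IndV.mk φ (ρ.prod σ) g v
        rw [← map_add, Prod.mk_add_mk, add_zero, zero_add]))
    fun g => LinearMap.ext fun x => Prod.ext
      (IntertwiningMap.isIntertwining _ _ (indHom φ (IntertwiningMap.fst k ρ σ)) g x)
      (IntertwiningMap.isIntertwining _ _ (indHom φ (IntertwiningMap.snd k ρ σ)) g x)

variable [Finite G]

/-- The induced representation `k[G] ⊗_{k[H]} A`, for `φ : H →* G` with `G` finite. -/
def FinRep.ind (A : FinRep k H) : FinRep k G :=
  ⟨Rep.ind φ A.1, by
    have := A.2
    have : Module.Finite k (MonoidAlgebra k G) :=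
      Module.Finite.equiv (MonoidAlgebra.coeffLinearEquiv (M := G) k).symm
    exact Module.Finite.of_surjective
      (Coinvariants.mk (V := TensorProduct k (MonoidAlgebra k G) A.1.V)
        (Representation.tprod ((leftRegular k G).comp φ) A.1.ρ))
      (Coinvariants.mk_surjective _)⟩

/-- Induction on isomorphism classes, as a homomorphism of monoids. -/
def indClass : RepClass k H →+ RepClass k G where
  toFun := Quotient.map (FinRep.ind φ) fun _ _ ⟨e⟩ => ⟨indEquiv φ e⟩
  map_zero' := by
    refine Quotient.sound ⟨Representation.Equiv.mk (LinearEquiv.ofLinearMap 0 0 ?_ ?_) fun g => ?_⟩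
    · exact LinearMap.ext fun x => rfl
    · exact IndV.hom_ext φ _ fun g => LinearMap.ext fun v => (map_zero (IndV.mk φ _ g)).symm
    · exact LinearMap.ext fun x => rfl
  map_add' := by
    rintro ⟨A⟩ ⟨B⟩
    exact Quotient.sound ⟨indProdEquiv φ A.1.ρ B.1.ρ⟩

variable (k) in
/-- The induction homomorphism of representation groups along a homomorphism `φ : H →* G`
(the usual `Ind_H^G` when `φ` is the inclusion of a subgroup). -/
def Ind : RepGroup k H →+ RepGroup k G :=
  Algebra.GrothendieckAddGroup.lift (Algebra.GrothendieckAddGroup.of.comp (indClass φ))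

end Induction

end RepGrp

end

/-!
In characteristic zero a representation of a finite group is determined by its character
(`Representation.nonempty_equiv_of_character_eq`), so the representation group embeds into the
functions on the group (`RepGrp.virtualChar_injective`) and injectivity of induction becomes a
question about characters. By Frobenius' formula (`Representation.char_ind`), the restriction to
`N = SL(2, F)` of a character induced to `G = GL(2, F)` is, up to a nonzero scalar, the sum of the
`G`-conjugates of the original character. Hence induction is injective if every character of `N`
is stable under conjugation by `G` (`RepGrp.Ind_injective_of_stable`), and it fails to be
injective as soon as one character of an actual representation is not stable, because a
representation and its conjugate have isomorphic inductions
(`RepGrp.not_Ind_injective_of_not_stable`).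

Conjugation by an element of square determinant is inner on `N` up to a scalar. This settles
characteristic two, over both fields. Every `x ∈ N` is inverted by a matrix of determinant `-1`
(`SLTwo.exists_conjSL_eq_inv`). If `q ≡ 3 mod 4`, then `-1` is not a square, so conjugation by `G`
maps `x` to an `N`-conjugate of `x` or of `x⁻¹`; real characters take the same value on `x` and
`x⁻¹` (`Representation.character_inv_of_real`), so they are stable.

For odd `q` and a nonsquare `a`, the unipotent elements with parameters `1` and `a` are conjugate in
`G` but not in `N`. The difference of the numbers of elements of `N` that conjugate each of them to
the unipotent element with parameter `t` is a nonzero function `f` of `t`, so some additive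
character `ψ` has `∑ t, ψ t * f t ≠ 0`. The representation induced from `ψ` on the unipotent
subgroup then has a character that separates the two elements. If `-1` is a square, `f` is even, the
sum is real, and the real representation underlying `ψ` serves in the same way over `ℝ`.
-/

noncomputable section

/-! ### Characters determine representations -/

namespace Representation

open Module

section Decomposition

variable {k G V : Type*} [Field k] [Group G] [AddCommGroup V] [Module k V]
  {ρ : Representation k G V}

/-- A representation is the direct sum of two complementary subrepresentations. -/
def prodEquivOfIsCompl {p q : Subrepresentation ρ} (h : IsCompl p.toSubmodule q.toSubmodule) :
    (p.toRepresentation.prod q.toRepresentation).Equiv ρ :=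
  Representation.Equiv.mk (Submodule.prodEquivOfIsCompl _ _ h) fun g => by
    refine LinearMap.ext fun x => ?_
    simp [Subrepresentation.toRepresentation]

theorem exists_isCompl_subrepresentation [Finite G] [CharZero k] (p : Subrepresentation ρ) :
    ∃ q : Subrepresentation ρ, IsCompl p.toSubmodule q.toSubmodule := by
  have : NeZero (Nat.card G : k) := ⟨Nat.cast_ne_zero.2 Nat.card_pos.ne'⟩
  have : ComplementedLattice (Subrepresentation ρ) :=
    (isSemisimpleRepresentation_iff_isSemisimpleModule_asModule ρ).2 inferInstance
  obtain ⟨q, hq⟩ := exists_isCompl p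
  refine ⟨q, IsCompl.of_eq ?_ ?_⟩
  · exact congrArg Subrepresentation.toSubmodule hq.inf_eq_bot
  · exact congrArg Subrepresentation.toSubmodule hq.sup_eq_top

/-- An intertwining map identifies a complement of its kernel with its range. -/
theorem nonempty_equiv_range {W : Type*} [AddCommGroup W] [Module k W]
    {σ : Representation k G W} (f : IntertwiningMap ρ σ) {q : Subrepresentation ρ}
    (h : IsCompl f.ker.toSubmodule q.toSubmodule) :
    Nonempty (q.toRepresentation.Equiv f.range.toRepresentation) := by
  let e : q.toSubmodule ≃ₗ[k] f.range.toSubmodule :=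
    (Submodule.quotientEquivOfIsCompl _ _ h).symm ≪≫ₗ f.toLinearMap.quotKerEquivRange
  refine ⟨Representation.Equiv.mk e fun g => LinearMap.ext fun x => Subtype.ext ?_⟩
  exact IntertwiningMap.isIntertwining _ _ f g x.1

end Decomposition

section Character

variable {k G V W : Type*} [Field k] [Group G] [AddCommGroup V] [Module k V]
  [AddCommGroup W] [Module k W] [FiniteDimensional k V] [FiniteDimensional k W]

theorem char_prod (ρ : Representation k G V) (σ : Representation k G W) :
    (ρ.prod σ).character = ρ.character + σ.character :=
  funext fun g => LinearMap.trace_prodMap' (ρ g) (σ g)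

theorem exists_intertwiningMap_ne_zero_of_character_eq [Finite G] [CharZero k] [Nontrivial V]
    {ρ : Representation k G V} {σ : Representation k G W} (h : ρ.character = σ.character) :
    ∃ f : IntertwiningMap ρ σ, f ≠ 0 := by
  have := Fintype.ofFinite G
  have : Invertible (Nat.card G : k) := invertibleOfNonzero (Nat.cast_ne_zero.2 Nat.card_pos.ne')
  have key : finrank k (IntertwiningMap ρ σ) = finrank k (IntertwiningMap ρ ρ) := by
    have h₁ := card_inv_mul_sum_char_mul_char_eq_finrank ρ σ
    rw [← h, card_inv_mul_sum_char_mul_char_eq_finrank ρ ρ] at h₁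
    exact_mod_cast h₁.symm
  have : FiniteDimensional k (IntertwiningMap ρ ρ) :=
    FiniteDimensional.of_injective (IntertwiningMap.toLinearMapl ρ ρ)
      (IntertwiningMap.toLinearMap_injective _ _)
  have : FiniteDimensional k (IntertwiningMap ρ σ) :=
    FiniteDimensional.of_injective (IntertwiningMap.toLinearMapl ρ σ)
      (IntertwiningMap.toLinearMap_injective _ _)
  have hne : (IntertwiningMap.id ρ) ≠ 0 := fun h0 => by
    obtain ⟨v, hv⟩ := exists_ne (0 : V)
    exact hv congr($h0 v)
  have : Nontrivial (IntertwiningMap ρ ρ) := ⟨_, _, hne⟩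
  have : Nontrivial (IntertwiningMap ρ σ) := by
    rw [← finrank_pos_iff (R := k), key]
    exact finrank_pos
  exact exists_ne 0

end Character

/-- In characteristic zero, the character determines a representation of a finite group.
A nonzero intertwining map `f : ρ → σ` exists because `⟨χ, χ⟩ ≠ 0`; splitting off the complement
of its kernel from `ρ` and its range from `σ` lowers the dimension. -/
theorem nonempty_equiv_of_character_eq {k G : Type*} [Field k] [CharZero k] [Group G] [Finite G]
    {V W : Type u} [AddCommGroup V] [Module k V] [AddCommGroup W] [Module k W]
    [FiniteDimensional k V] [FiniteDimensional k W]
    {ρ : Representation k G V} {σ : Representation k G W} (h : ρ.character = σ.character) :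
    Nonempty (ρ.Equiv σ) := by
  induction hn : finrank k V using Nat.strong_induction_on generalizing V W with
  | _ n ih =>
    have hVW : finrank k V = finrank k W := by
      have := congrFun h 1
      rw [char_one, char_one] at this
      exact_mod_cast this
    rcases subsingleton_or_nontrivial V with hV | hV
    · have hW : Subsingleton W := by
        rw [← finrank_zero_iff (R := k), ← hVW, finrank_zero_of_subsingleton]
      exact ⟨Representation.Equiv.mk 0 fun g => Subsingleton.elim _ _⟩
    · obtain ⟨f, hf⟩ := exists_intertwiningMap_ne_zero_of_character_eq h
      obtain ⟨q, hq⟩ := exists_isCompl_subrepresentation f.ker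
      obtain ⟨s, hs⟩ := exists_isCompl_subrepresentation f.range
      obtain ⟨e⟩ := nonempty_equiv_range f hq
      have hlt : finrank k f.ker.toSubmodule < n := by
        rw [← hn]
        refine Submodule.finrank_lt fun htop => hf ?_
        ext v
        exact (htop ▸ Submodule.mem_top : v ∈ f.ker.toSubmodule)
      have hchar : f.ker.toRepresentation.character = s.toRepresentation.character := by
        have h₁ := char_iso (prodEquivOfIsCompl hq)
        have h₂ := char_iso (prodEquivOfIsCompl hs)
        rw [char_prod] at h₁ h₂
        rw [h, ← h₂, char_iso e, add_comm] at h₁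
        exact add_left_cancel h₁
      obtain ⟨e'⟩ := ih _ hlt hchar rfl
      refine ⟨(prodEquivOfIsCompl hq).symm.trans (Representation.Equiv.trans ?_
        (prodEquivOfIsCompl hs))⟩
      refine Representation.Equiv.mk ((e'.toLinearEquiv.prodCongr e.toLinearEquiv) ≪≫ₗ
        LinearEquiv.prodComm k _ _) fun g => LinearMap.ext fun x => Prod.ext ?_ ?_
      · exact IntertwiningMap.isIntertwining _ _ e.toIntertwiningMap g x.2
      · exact IntertwiningMap.isIntertwining _ _ e'.toIntertwiningMap g x.1

/-- A representation of a finite group on a finite-dimensional real vector space has a real-valued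
character, hence one that is invariant under inversion: averaging a positive definite form over
the group identifies the representation with its dual. -/
theorem character_inv_of_real {G V : Type*} [Group G] [Finite G] [AddCommGroup V] [Module ℝ V]
    [FiniteDimensional ℝ V] (ρ : Representation ℝ G V) (g : G) :
    ρ.character g⁻¹ = ρ.character g := by
  have := Fintype.ofFinite G
  -- `c` is the standard positive definite form in a basis, and `B` its average over the group.
  let b := finBasis ℝ V
  let c : V →ₗ[ℝ] Dual ℝ V := ∑ i, (b.coord i).smulRight (b.coord i)
  have hc : ∀ v w, c v w = ∑ i, b.coord i v * b.coord i w := fun v w => by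
    simp [c]
  let B : V →ₗ[ℝ] Dual ℝ V := ∑ h : G, (Dual.transpose (R := ℝ) (ρ h)) ∘ₗ c ∘ₗ ρ h
  have hB : ∀ v w, B v w = ∑ h : G, c (ρ h v) (ρ h w) := fun v w => by
    simp [B, Dual.transpose_apply]
  have hinj : Function.Injective B := by
    refine (injective_iff_map_eq_zero B).2 fun v hv => ?_
    have h0 : ∑ h : G, c (ρ h v) (ρ h v) = 0 := by rw [← hB, hv]; rfl
    have hpos : ∀ w, 0 ≤ c w w := fun w => by
      rw [hc]; exact Finset.sum_nonneg fun i _ => mul_self_nonneg _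
    have h1 := (Finset.sum_eq_zero_iff_of_nonneg fun h _ => hpos (ρ h v)).1 h0 1
      (Finset.mem_univ _)
    rw [map_one, Module.End.one_apply, hc,
      Finset.sum_eq_zero_iff_of_nonneg fun i _ => mul_self_nonneg _] at h1
    exact b.ext_elem fun i => by simpa using h1 i (Finset.mem_univ _)
  let e : V ≃ₗ[ℝ] Dual ℝ V :=
    LinearEquiv.ofInjectiveOfFinrankEq B hinj Subspace.dual_finrank_eq.symm
  have he : ρ.Equiv ρ.dual := Representation.Equiv.mk e fun x =>
    LinearMap.ext fun v => LinearMap.ext fun w => by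
      change B (ρ x v) w = B v (ρ x⁻¹ w)
      rw [hB, hB]
      refine Fintype.sum_equiv (Equiv.mulRight x) _ _ fun h => ?_
      simp [← Module.End.mul_apply, ← map_mul]
  rw [← char_dual, ← char_iso he]

end Representation

/-! ### Characters of induced representations -/

namespace Representation

open Module

open scoped MonoidAlgebra

section Induced

variable {k H V : Type*} [Field k] [CharZero k] [Group H] [Fintype H] [AddCommGroup V] [Module k V]
  [FiniteDimensional k V]

/-- The averaging projector factors through the coinvariants as a section of the quotient map,
so traces on the coinvariants can be computed upstairs. -/
theorem trace_coinvariants_map (τ : Representation k H V) (f : IntertwiningMap τ τ) :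
    LinearMap.trace k _ (Coinvariants.map τ τ f) =
      (Fintype.card H : k)⁻¹ * ∑ h : H, LinearMap.trace k V (f.toLinearMap ∘ₗ τ h) := by
  -- `P` is the averaging projector and `s` the section of the quotient map through which it factors.
  let P : V →ₗ[k] V := (Fintype.card H : k)⁻¹ • ∑ h : H, τ h
  have hP : ∀ h, P ∘ₗ τ h = P := fun h => by
    refine LinearMap.ext fun v => ?_
    simp only [P, LinearMap.comp_apply, LinearMap.smul_apply, LinearMap.sum_apply]
    congr 1
    refine Fintype.sum_equiv (Equiv.mulRight h) _ _ fun x => ?_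
    simp
  let s := Coinvariants.lift τ P hP
  have hs : Coinvariants.mk τ ∘ₗ s = LinearMap.id := by
    refine Coinvariants.hom_ext (LinearMap.ext fun v => ?_)
    have hcard : (Fintype.card H : k) ≠ 0 := Nat.cast_ne_zero.2 Fintype.card_ne_zero
    simp [s, P, ← Nat.cast_smul_eq_nsmul k, smul_smul, hcard]
  have hmap : Coinvariants.map τ τ f = Coinvariants.mk τ ∘ₗ (f.toLinearMap ∘ₗ s) := by
    rw [← LinearMap.comp_id (Coinvariants.map τ τ f), ← hs, ← LinearMap.comp_assoc,
      Coinvariants.map_comp_mk, LinearMap.comp_assoc]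
    rfl
  have hsmk : s ∘ₗ Coinvariants.mk τ = P := Coinvariants.lift_comp_mk _ _ _
  rw [hmap, LinearMap.trace_comp_comm', LinearMap.comp_assoc, hsmk, LinearMap.comp_smul, map_smul,
    smul_eq_mul, ← Module.End.mul_eq_comp, Finset.mul_sum, map_sum]
  rfl

omit [CharZero k] in
theorem trace_mapDomain {G : Type*} [Fintype G] [DecidableEq G] (a : G → G) :
    LinearMap.trace k _ (MonoidAlgebra.mapDomainLinearMap k k a) =
      ∑ g : G, if a g = g then 1 else 0 := by
  let b : Basis G k k[G] := Basis.ofRepr (MonoidAlgebra.coeffLinearEquiv k)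
  have hb : ∀ g, b g = MonoidAlgebra.single g 1 := fun g => rfl
  have hr : ∀ x g, b.repr x g = x.coeff g := fun x g => rfl
  rw [LinearMap.trace_eq_matrix_trace k b, Matrix.trace]
  refine Finset.sum_congr rfl fun g _ => ?_
  rw [Matrix.diag_apply, LinearMap.toMatrix_apply, hb, hr]
  simp [Finsupp.single_apply]

/-- Frobenius' formula for the character of the representation induced along `φ : H →* G`. -/
theorem char_ind {G : Type*} [Group G] [Fintype G] [DecidableEq G] (φ : H →* G)
    (ρ : Representation k H V) (x : G) :
    (ρ.ind φ).character x =
      (Fintype.card H : k)⁻¹ * ∑ h : H, ∑ g : G, if φ h = g * x * g⁻¹ then ρ.character h else 0 := by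
  have : Module.Finite k k[G] := Module.Finite.equiv (MonoidAlgebra.coeffLinearEquiv (M := G) k).symm
  rw [character, ind_apply, trace_coinvariants_map]
  congr 1
  refine Finset.sum_congr rfl fun h _ => ?_
  have hcomp : (MonoidAlgebra.mapDomainLinearMap k k fun y => y * x⁻¹).rTensor V ∘ₗ
      (tprod ((leftRegular k G).comp φ) ρ) h =
      TensorProduct.map (MonoidAlgebra.mapDomainLinearMap k k fun y => φ h * y * x⁻¹) (ρ h) := by
    ext y v
    simp
  refine (congrArg _ hcomp).trans ?_
  rw [LinearMap.trace_tensorProduct', trace_mapDomain, Finset.sum_mul]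
  refine Finset.sum_congr rfl fun g _ => ?_
  have hiff : φ h * g * x⁻¹ = g ↔ φ h = g * x * g⁻¹ := by
    rw [mul_inv_eq_iff_eq_mul, eq_mul_inv_iff_mul_eq]
  simp only [hiff, ite_mul, one_mul, zero_mul, character]

end Induced

end Representation

/-! ### Virtual characters and induction -/

namespace RepGrp

open Representation

section CharHom

variable {k : Type} [Field k] {G : Type u} [Group G]

/-- The character of an isomorphism class of representations. -/
def classChar : RepClass k G →+ (G → k) where
  toFun := Quotient.lift (fun A => A.1.ρ.character) fun _ _ ⟨e⟩ => char_iso e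
  map_zero' := funext fun g => LinearMap.map_zero (LinearMap.trace k PUnit.{u + 1})
  map_add' := by
    rintro ⟨A⟩ ⟨B⟩
    have := A.2
    have := B.2
    exact char_prod A.1.ρ B.1.ρ

/-- The character of a virtual representation. -/
def virtualChar : RepGroup k G →+ (G → k) := Algebra.GrothendieckAddGroup.lift classChar

theorem virtualChar_of (a : RepClass k G) :
    virtualChar (Algebra.GrothendieckAddGroup.of a) = classChar a :=
  DFunLike.congr_fun (Algebra.GrothendieckAddGroup.lift.symm_apply_apply (classChar (k := k))) a

theorem exists_eq_of_sub_of {M : Type*} [AddCommMonoid M] (x : Algebra.GrothendieckAddGroup M) :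
    ∃ a b : M, x = Algebra.GrothendieckAddGroup.of a - Algebra.GrothendieckAddGroup.of b := by
  obtain ⟨⟨a, b⟩, h⟩ := (AddLocalization.addMonoidOf (⊤ : AddSubmonoid M)).surj x
  exact ⟨a, b, eq_sub_of_add_eq h⟩

theorem classChar_injective [CharZero k] [Finite G] :
    Function.Injective (classChar : RepClass k G →+ (G → k)) := by
  rintro ⟨A⟩ ⟨B⟩ h
  have := A.2
  have := B.2
  exact Quotient.sound (nonempty_equiv_of_character_eq h)

theorem virtualChar_injective [CharZero k] [Finite G] :
    Function.Injective (virtualChar : RepGroup k G →+ (G → k)) := by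
  refine (injective_iff_map_eq_zero _).2 fun x hx => ?_
  obtain ⟨a, b, rfl⟩ := exists_eq_of_sub_of x
  rw [map_sub, virtualChar_of, virtualChar_of, sub_eq_zero] at hx
  rw [classChar_injective hx, sub_self]

/-- Additive functions that agree on characters agree on virtual characters. -/
theorem virtualChar_eq_of_forall {M : Type*} [AddCommGroup M] (S T : (G → k) →+ M)
    (h : ∀ A : FinRep k G, S A.1.ρ.character = T A.1.ρ.character) (x : RepGroup k G) :
    S (virtualChar x) = T (virtualChar x) := by
  obtain ⟨a, b, rfl⟩ := exists_eq_of_sub_of x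
  have key : ∀ a : RepClass k G, S (classChar a) = T (classChar a) := by
    rintro ⟨A⟩
    exact h A
  rw [map_sub, virtualChar_of, virtualChar_of, map_sub, map_sub, key, key]

end CharHom

section Ind

variable {k : Type} [Field k] [CharZero k] {H G : Type u} [Group H] [Group G] [Fintype H]
  [Fintype G] [DecidableEq G] (φ : H →* G)

omit [CharZero k] [Fintype H] [DecidableEq G] in
theorem Ind_of (a : RepClass k H) : Ind k φ (Algebra.GrothendieckAddGroup.of a) =
    Algebra.GrothendieckAddGroup.of (indClass φ a) :=
  DFunLike.congr_fun (Algebra.GrothendieckAddGroup.lift.symm_apply_apply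
    (Algebra.GrothendieckAddGroup.of.comp (indClass (k := k) φ))) a

theorem virtualChar_Ind (x : RepGroup k H) (y : G) :
    virtualChar (Ind k φ x) y =
      (Fintype.card H : k)⁻¹ *
        ∑ h : H, ∑ g : G, if φ h = g * y * g⁻¹ then virtualChar x h else 0 := by
  obtain ⟨a, b, rfl⟩ := exists_eq_of_sub_of x
  have key : ∀ a : RepClass k H, classChar (indClass φ a) y =
      (Fintype.card H : k)⁻¹ *
        ∑ h : H, ∑ g : G, if φ h = g * y * g⁻¹ then classChar a h else 0 := by
    rintro ⟨A⟩
    have := A.2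
    exact char_ind φ A.1.ρ y
  simp only [map_sub, Ind_of, virtualChar_of, Pi.sub_apply, key, ← mul_sub,
    ← Finset.sum_sub_distrib]
  congr! 3 with h _ g _
  split_ifs <;> simp

/-- If `φ` embeds `H` as a normal subgroup, on which conjugation by `G` is given by `c`, and all
characters of `H` are `G`-stable, then induction multiplies them by the index on `H`, and so is
injective. -/
theorem Ind_injective_of_stable (hφ : Function.Injective φ) (c : G → H → H)
    (hc : ∀ g h, φ (c g h) = g * φ h * g⁻¹)
    (hst : ∀ (A : FinRep k H) (g : G) (h : H), A.1.ρ.character (c g h) = A.1.ρ.character h) :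
    Function.Injective (Ind k φ) := by
  refine (injective_iff_map_eq_zero _).2 fun x hx => virtualChar_injective ?_
  rw [map_zero]
  ext y
  have hst' : ∀ g, virtualChar x (c g y) = virtualChar x y := fun g =>
    virtualChar_eq_of_forall (Pi.evalAddMonoidHom _ (c g y)) (Pi.evalAddMonoidHom _ y)
      (fun A => hst A g y) x
  -- In Frobenius' formula at `φ y`, each `g` contributes the single term `h = c g y`.
  have h0 := virtualChar_Ind φ x (φ y)
  rw [hx, map_zero, Finset.sum_comm] at h0
  have hin : ∀ g : G, (∑ h : H, if φ h = g * φ y * g⁻¹ then virtualChar x h else 0) =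
      virtualChar x y := fun g => by
    rw [Finset.sum_eq_single (c g y) (fun h _ hne => ?_) (by simp), if_pos (hc g y), hst']
    exact if_neg fun h' => hne (hφ (h'.trans (hc g y).symm))
  simp only [hin, Finset.sum_const, Finset.card_univ, nsmul_eq_mul, Pi.zero_apply] at h0
  have hH : (Fintype.card H : k)⁻¹ ≠ 0 := inv_ne_zero (Nat.cast_ne_zero.2 Fintype.card_ne_zero)
  have hG : (Fintype.card G : k) ≠ 0 := Nat.cast_ne_zero.2 Fintype.card_ne_zero
  simpa [hH, hG] using h0.symm

/-- The restriction of a representation along a homomorphism. -/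
def FinRep.comap {K : Type u} [Group K] (A : FinRep k H) (α : K →* H) : FinRep k K :=
  ⟨Rep.of (A.1.ρ.comp α), A.2⟩

/-- If an automorphism `α` of `H` is conjugation by some `t : G`, then a representation and its
twist by `α` have isomorphic inductions, whereas their classes differ as soon as the character
is not `α`-stable. -/
theorem not_Ind_injective_of_not_stable (α : H ≃* H) (t : G)
    (hα : ∀ h, φ (α h) = t * φ h * t⁻¹) (A : FinRep k H) (y : H)
    (hy : A.1.ρ.character (α y) ≠ A.1.ρ.character y) : ¬ Function.Injective (Ind k φ) := by
  intro hinj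
  let a : RepGroup k H := Algebra.GrothendieckAddGroup.of (⟦A.comap α.toMonoidHom⟧ : RepClass k H)
  let b : RepGroup k H := Algebra.GrothendieckAddGroup.of (⟦A⟧ : RepClass k H)
  have ha : ∀ h, virtualChar a h = A.1.ρ.character (α h) := fun h =>
    congrFun (virtualChar_of _) h
  have hb : ∀ h, virtualChar b h = A.1.ρ.character h := fun h => congrFun (virtualChar_of _) h
  have hab : a = b := by
    refine hinj (virtualChar_injective (funext fun x => ?_))
    rw [virtualChar_Ind, virtualChar_Ind]
    congr 1
    -- Reindexing by `h ↦ α h` and `g ↦ t * g` matches the two formulas term by term.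
    refine Fintype.sum_equiv α.toEquiv _ _ fun h => ?_
    refine Fintype.sum_equiv (Equiv.mulLeft t) _ _ fun g => ?_
    have hiff : φ h = g * x * g⁻¹ ↔ φ (α h) = t * g * x * (t * g)⁻¹ := by
      rw [hα, ← mul_right_inj t, ← mul_left_inj t⁻¹]
      simp [mul_assoc]
    simp [ha, hb, hiff]
  exact hy (by rw [← ha, ← hb, hab])

end Ind

end RepGrp

/-! ### Conjugation in `SL(2, F)` -/

namespace SLTwo

open Matrix

open scoped MatrixGroups

variable {F : Type u} [Field F]

/-- Conjugation by an element of `GL(2, F)`, as an automorphism of `SL(2, F)`. -/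
def conjSL (g : GL (Fin 2) F) : SL(2, F) ≃* SL(2, F) where
  toFun x := ⟨g.1 * x.1 * g⁻¹.1, by
    rw [det_mul_right_comm, ← Units.val_mul, mul_inv_cancel, Units.val_one, one_mul, x.2]⟩
  invFun x := ⟨g⁻¹.1 * x.1 * g.1, by
    rw [det_mul_right_comm, ← Units.val_mul, inv_mul_cancel, Units.val_one, one_mul, x.2]⟩
  left_inv x := Subtype.ext <| by simp [Matrix.mul_assoc]
  right_inv x := Subtype.ext <| by simp [Matrix.mul_assoc]
  map_mul' x y := Subtype.ext <| by
    change g.1 * (x.1 * y.1) * g⁻¹.1 = g.1 * x.1 * g⁻¹.1 * (g.1 * y.1 * g⁻¹.1)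
    simp [Matrix.mul_assoc]

theorem toGL_conjSL (g : GL (Fin 2) F) (x : SL(2, F)) :
    SpecialLinearGroup.toGL (conjSL g x) =
      g * SpecialLinearGroup.toGL x * g⁻¹ := Units.ext rfl

theorem toGL_injective :
    Function.Injective (SpecialLinearGroup.toGL : SL(2, F) →* GL (Fin 2) F) := fun _ _ h =>
  Subtype.ext (congrArg Units.val h)

theorem conjSL_mul (g h : GL (Fin 2) F) (x : SL(2, F)) :
    conjSL (g * h) x = conjSL g (conjSL h x) :=
  toGL_injective <| by simp only [toGL_conjSL, _root_.mul_inv_rev, mul_assoc]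

/-- Up to a scalar, an element of `GL(2, F)` with square determinant lies in `SL(2, F)`. -/
theorem exists_conjSL_eq_conj {g : GL (Fin 2) F} (hg : IsSquare g.1.det) :
    ∃ n : SL(2, F), ∀ x, conjSL g x = n * x * n⁻¹ := by
  obtain ⟨s, hs⟩ := hg
  have hs0 : s ≠ 0 := by
    rintro rfl
    exact (GeneralLinearGroup.det_ne_zero g) (by simpa using hs)
  refine ⟨⟨s⁻¹ • g.1, ?_⟩, fun x => eq_mul_inv_of_mul_eq (Subtype.ext ?_)⟩
  · rw [det_smul, hs, Fintype.card_fin]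
    field_simp
  · change g.1 * x.1 * g⁻¹.1 * (s⁻¹ • g.1) = s⁻¹ • g.1 * x.1
    simp [Matrix.mul_assoc]

/-- Every `x ∈ SL(2, F)` is inverted by a matrix of determinant `-1`: if `v` is not an eigenvector
of `x`, then the matrix that fixes `v` and maps `x v` to `x⁻¹ v` does so, and `v` may be taken in
the standard basis unless `x` is diagonal, in which case swapping the coordinates inverts `x`. -/
theorem exists_conjSL_eq_inv (x : SL(2, F)) :
    ∃ g : GL (Fin 2) F, g.1.det = -1 ∧ conjSL g x = x⁻¹ := by
  suffices h : ∃ A : Matrix (Fin 2) (Fin 2) F, A.det = -1 ∧ A * x.1 = x.1.adjugate * A by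
    obtain ⟨A, hA, hAx⟩ := h
    have hu : A.det ≠ 0 := by simp [hA]
    refine ⟨GeneralLinearGroup.mkOfDetNeZero A hu, hA, toGL_injective ?_⟩
    rw [toGL_conjSL, mul_inv_eq_iff_eq_mul]
    exact Units.ext hAx
  have hdet : x.1 0 0 * x.1 1 1 - x.1 0 1 * x.1 1 0 = 1 := by rw [← det_fin_two]; exact x.2
  obtain ⟨a, b, c, d, hx⟩ : ∃ a b c d, x.1 = !![a, b; c, d] := ⟨_, _, _, _, eta_fin_two x.1⟩
  rw [hx] at hdet ⊢
  rw [adjugate_fin_two]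
  simp only [of_apply, cons_val', cons_val_zero, cons_val_fin_one, cons_val_one] at hdet ⊢
  by_cases hc : c = 0
  · by_cases hb : b = 0
    · refine ⟨!![0, 1; 1, 0], by simp, ?_⟩
      simp [hb, hc]
    · refine ⟨!![-1, 0; (a - d) / b, 1], by simp, ?_⟩
      ext i j
      fin_cases i <;> fin_cases j <;> simp [hc] <;> field_simp <;> ring
  · refine ⟨!![1, (d - a) / c; 0, -1], by simp, ?_⟩
    ext i j
    fin_cases i <;> fin_cases j <;> simp <;> field_simp <;> ring

/-- The embedding `t ↦ [1, t; 0, 1]` of the additive group of `F` as the upper unitriangular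
matrices. -/
def unipotent : Multiplicative F →* SL(2, F) where
  toFun t := ⟨!![1, t.toAdd; 0, 1], by simp⟩
  map_one' := Subtype.ext <| by simp [one_fin_two]
  map_mul' s t := Subtype.ext <| by
    change !![1, s.toAdd + t.toAdd; 0, 1] = !![1, s.toAdd; 0, 1] * !![1, t.toAdd; 0, 1]
    simp [add_comm]

/-- The diagonal matrix with entries `a` and `1`. -/
def diagOne (a : Fˣ) : GL (Fin 2) F :=
  GeneralLinearGroup.mkOfDetNeZero !![a.1, 0; 0, 1] (by simp)

theorem conjSL_diagOne_unipotent (a : Fˣ) (t : F) :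
    conjSL (diagOne a) (unipotent (.ofAdd t)) = unipotent (.ofAdd (a * t)) := by
  refine toGL_injective ?_
  rw [toGL_conjSL, mul_inv_eq_iff_eq_mul]
  refine Units.ext ?_
  change !![a.1, 0; 0, 1] * !![1, t; 0, 1] = !![1, a * t; 0, 1] * !![a.1, 0; 0, 1]
  simp

theorem isSquare_of_unipotent_conj {a : F} {g : SL(2, F)}
    (h : unipotent (.ofAdd 1) = g * unipotent (.ofAdd a) * g⁻¹) : IsSquare a := by
  rw [eq_mul_inv_iff_mul_eq] at h
  have hm : !![1, 1; 0, 1] * g.1 = g.1 * !![1, a; 0, 1] := congrArg Subtype.val h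
  have hdet := g.2
  rw [eta_fin_two g.1] at hm hdet
  rw [det_fin_two_of] at hdet
  have h00 := congrFun (congrFun hm 0) 0
  have h01 := congrFun (congrFun hm 0) 1
  simp only [mul_fin_two, of_apply, cons_val', cons_val_zero, cons_val_fin_one,
    cons_val_one] at h00 h01
  have hc : g.1 1 0 = 0 := by linear_combination h00
  have hd : g.1 1 1 = g.1 0 0 * a := by linear_combination h01
  refine ⟨g.1 1 1, ?_⟩
  rw [hc, hd] at hdet
  rw [hd]
  linear_combination -a * hdet

section Count

variable [Fintype F] [DecidableEq F]

/-- The number of `g ∈ SL(2, F)` that conjugate the unipotent element with parameter `t` to the one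
with parameter `s`. -/
def unipotentConjCount (s t : F) : ℕ :=
  Fintype.card {g : SL(2, F) // unipotent (.ofAdd s) = g * unipotent (.ofAdd t) * g⁻¹}

theorem unipotentConjCount_neg (h : IsSquare (-1 : F)) (s t : F) :
    unipotentConjCount (-s) t = unipotentConjCount s t := by
  obtain ⟨i, hi⟩ := h
  -- `diag(i, i⁻¹)` with `i ^ 2 = -1` negates the parameter of a unipotent element.
  let D : SL(2, F) := ⟨!![i, 0; 0, -i], by simp [← hi]⟩
  have hD : unipotent (.ofAdd (-s)) = D * unipotent (.ofAdd s) * D⁻¹ := by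
    rw [eq_mul_inv_iff_mul_eq]
    refine Subtype.ext ?_
    change !![1, -s; 0, 1] * !![i, 0; 0, -i] = !![i, 0; 0, -i] * !![1, s; 0, 1]
    simp [mul_comm]
  refine Fintype.card_congr (Equiv.subtypeEquiv (Equiv.mulLeft D⁻¹) fun g => ?_)
  rw [hD, ← mul_right_inj D⁻¹, ← mul_left_inj D]
  simp [mul_assoc]

theorem unipotentConjCount_one_one_ne_zero : unipotentConjCount (1 : F) 1 ≠ 0 := by
  have : Nonempty {g : SL(2, F) // unipotent (.ofAdd (1 : F)) = g * unipotent (.ofAdd 1) * g⁻¹} :=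
    ⟨1, by simp⟩
  exact Fintype.card_ne_zero

theorem unipotentConjCount_one_eq_zero {a : F} (ha : ¬ IsSquare a) :
    unipotentConjCount 1 a = 0 :=
  Fintype.card_eq_zero_iff.2 ⟨fun g => ha (isSquare_of_unipotent_conj g.2)⟩

end Count

end SLTwo

/-! ### Additive characters as representations -/

namespace SLTwo

open Matrix Representation RepGrp

open scoped MatrixGroups

/-- The functional `h ↦ ∑ t, h t * f t` vanishes on the basis of characters only if `f = 0`. -/
theorem exists_addChar_sum_ne_zero {A : Type*} [AddCommGroup A] [Fintype A] [DecidableEq A]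
    {f : A → ℂ} {a : A} (hf : f a ≠ 0) : ∃ ψ : AddChar A ℂ, ∑ t, ψ t * f t ≠ 0 := by
  by_contra! h
  let L : (A → ℂ) →ₗ[ℂ] ℂ := ∑ t, f t • LinearMap.proj t
  have hL : ∀ g, L g = ∑ t, g t * f t := fun g => by simp [L, mul_comm]
  have h0 : L = 0 := (AddChar.complexBasis A).ext fun ψ => by
    rw [AddChar.complexBasis_apply, hL, h, LinearMap.zero_apply]
  refine hf ?_
  have := hL (Pi.single a 1)
  simpa [h0, Pi.single_apply] using this.symm

section AddCharRep

variable (k : Type) [Field k] [Algebra k ℂ]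

/-- The additive group `A` acting on `ℂ` through the character `ψ`, as a representation over a
subfield `k` of `ℂ`. The carrier is lifted to an arbitrary universe, because induction of
representations here requires the carrier to lie in the universe of the group. -/
def addCharRep {A : Type*} [AddCommGroup A] (ψ : AddChar A ℂ) :
    Representation k (Multiplicative A) (ULift.{u} ℂ) :=
  ((Algebra.lmul k (ULift.{u} ℂ)).toMonoidHom.comp
    (ULift.algEquiv.{0, 0, u} (R := k) (A := ℂ)).symm.toAlgHom.toRingHom.toMonoidHom).comp
      ψ.toMonoidHom

theorem character_addCharRep {A : Type*} [AddCommGroup A] (ψ : AddChar A ℂ) (t : A) :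
    (addCharRep.{u} k ψ).character (.ofAdd t) = Algebra.trace k ℂ (ψ t) :=
  Algebra.trace_eq_of_algEquiv (ULift.algEquiv (R := k) (A := ℂ)).symm (ψ t)

instance [FiniteDimensional k ℂ] : FiniteDimensional k (ULift.{u} ℂ) :=
  Module.Finite.equiv (ULift.moduleEquiv (R := k) (M := ℂ)).symm

end AddCharRep

/-! ### Injectivity of induction -/

variable {F : Type u} [Field F]

theorem isSquare_mul_of_not_isSquare [Finite F] {a b : F} (ha : ¬ IsSquare a)
    (hb : ¬ IsSquare b) : IsSquare (a * b) := by
  classical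
  have := Fintype.ofFinite F
  have ha0 : a ≠ 0 := fun h => ha (h ▸ IsSquare.zero)
  have hb0 : b ≠ 0 := fun h => hb (h ▸ IsSquare.zero)
  rw [← quadraticChar_one_iff_isSquare (mul_ne_zero ha0 hb0), map_mul,
    quadraticChar_neg_one_iff_not_isSquare.2 ha, quadraticChar_neg_one_iff_not_isSquare.2 hb]
  norm_num

/-- If every element of `F` is a square, then `GL(2, F)` is generated by `SL(2, F)` and scalars, so
conjugation by it preserves the conjugacy classes of `SL(2, F)`. -/
theorem Ind_injective_of_forall_isSquare [Finite F] {k : Type} [Field k] [CharZero k]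
    (h : ∀ a : F, IsSquare a) :
    Function.Injective (Ind k (SpecialLinearGroup.toGL : SL(2, F) →* GL (Fin 2) F)) := by
  classical
  have := Fintype.ofFinite F
  refine Ind_injective_of_stable _ toGL_injective (fun g => conjSL g) toGL_conjSL
    fun A g x => ?_
  obtain ⟨n, hn⟩ := exists_conjSL_eq_conj (h g.1.det)
  rw [hn, char_conj]

/-- If `-1` is not a square, then conjugation by `GL(2, F)` maps `x ∈ SL(2, F)` to a conjugate of
`x` or of `x⁻¹` in `SL(2, F)`, and real characters do not separate these. -/
theorem Ind_real_injective_of_not_isSquare_neg_one [Finite F] (h : ¬ IsSquare (-1 : F)) :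
    Function.Injective (Ind ℝ (SpecialLinearGroup.toGL : SL(2, F) →* GL (Fin 2) F)) := by
  classical
  have := Fintype.ofFinite F
  refine Ind_injective_of_stable _ toGL_injective (fun g => conjSL g) toGL_conjSL
    fun A g x => ?_
  have := A.2
  by_cases hg : IsSquare g.1.det
  · obtain ⟨n, hn⟩ := exists_conjSL_eq_conj hg
    rw [hn, char_conj]
  · obtain ⟨d, hd, hdx⟩ := exists_conjSL_eq_inv x
    have hgd : IsSquare (g * d).1.det := by
      rw [Units.val_mul, det_mul, hd]
      exact isSquare_mul_of_not_isSquare hg h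
    obtain ⟨n, hn⟩ := exists_conjSL_eq_conj hgd
    have hgx : conjSL g x = (conjSL (g * d) x)⁻¹ := by
      rw [conjSL_mul, hdx, map_inv, inv_inv]
    rw [hgx, character_inv_of_real, hn, char_conj]

/-! ### Failure of injectivity -/

section NotInjective

variable [Fintype F] [DecidableEq F] (k : Type) [Field k] [CharZero k] [Algebra k ℂ]
  [FiniteDimensional k ℂ]

/-- The representation of `SL(2, F)` over `k` induced from the unipotent subgroup, acting on `ℂ`
through the character `ψ`. -/
def unipotentInd (ψ : AddChar F ℂ) : FinRep k SL(2, F) :=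
  FinRep.ind (unipotent (F := F)) ⟨Rep.of (addCharRep.{u} k ψ),
    inferInstanceAs (FiniteDimensional k (ULift.{u} ℂ))⟩

theorem character_unipotentInd (ψ : AddChar F ℂ) (a : F) :
    (unipotentInd k ψ).1.ρ.character (unipotent (.ofAdd a)) =
      (Fintype.card F : k)⁻¹ * Algebra.trace k ℂ (∑ t, ψ t * unipotentConjCount t a) := by
  refine (char_ind _ (addCharRep.{u} k ψ) _).trans ?_
  rw [Fintype.card_multiplicative, map_sum]
  congr 1
  refine Fintype.sum_equiv Multiplicative.toAdd _ _ fun t => ?_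
  rw [← Finset.sum_filter, Finset.sum_const, ← Fintype.card_subtype, ← ofAdd_toAdd t,
    character_addCharRep, mul_comm, ← nsmul_eq_mul, map_nsmul]
  rfl

/-- For a nonsquare `a`, the unipotent elements with parameters `1` and `a` are conjugate in
`GL(2, F)`. The character of a representation induced from the unipotent subgroup takes different
values on them if the trace to `k` of the sum in `htr` is nonzero; for some `ψ` the sum itself is
nonzero, because its coefficient at `t = 1` is. -/
theorem not_Ind_injective_of_trace_ne_zero {a : F} (ha : ¬ IsSquare a)
    (htr : ∀ ψ : AddChar F ℂ,
      ∑ t, ψ t * ((unipotentConjCount t 1 : ℂ) - unipotentConjCount t a) ≠ 0 →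
        Algebra.trace k ℂ (∑ t, ψ t * ((unipotentConjCount t 1 : ℂ) - unipotentConjCount t a)) ≠ 0) :
    ¬ Function.Injective (Ind k (SpecialLinearGroup.toGL : SL(2, F) →* GL (Fin 2) F)) := by
  have ha0 : a ≠ 0 := fun h => ha (h ▸ IsSquare.zero)
  have h1 : (unipotentConjCount (1 : F) 1 : ℂ) - unipotentConjCount 1 a ≠ 0 := by
    rw [unipotentConjCount_one_eq_zero ha, Nat.cast_zero, sub_zero]
    exact Nat.cast_ne_zero.2 unipotentConjCount_one_one_ne_zero
  obtain ⟨ψ, hψ⟩ := exists_addChar_sum_ne_zero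
    (f := fun t : F => (unipotentConjCount t 1 : ℂ) - unipotentConjCount t a) h1
  refine not_Ind_injective_of_not_stable _ (conjSL (diagOne (Units.mk0 a ha0))) _ (toGL_conjSL _)
    (unipotentInd k ψ) (unipotent (.ofAdd 1)) fun heq => htr ψ hψ ?_
  rw [conjSL_diagOne_unipotent, Units.val_mk0, mul_one, character_unipotentInd,
    character_unipotentInd] at heq
  have hcard : (Fintype.card F : k)⁻¹ ≠ 0 := inv_ne_zero (Nat.cast_ne_zero.2 Fintype.card_ne_zero)
  simp only [mul_sub, Finset.sum_sub_distrib]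
  rw [map_sub, mul_left_cancel₀ hcard heq, sub_self]

end NotInjective

theorem not_Ind_complex_injective [Finite F] (hF : ringChar F ≠ 2) :
    ¬ Function.Injective (Ind ℂ (SpecialLinearGroup.toGL : SL(2, F) →* GL (Fin 2) F)) := by
  classical
  have := Fintype.ofFinite F
  obtain ⟨a, ha⟩ := FiniteField.exists_nonsquare hF
  refine not_Ind_injective_of_trace_ne_zero ℂ ha fun ψ hψ => ?_
  rwa [Algebra.trace_self_apply]

/-- If `-1` is a square, then the conjugation counts are even functions, so the character sum is
real and has nonzero real part. -/
theorem not_Ind_real_injective [Finite F] (hF : ringChar F ≠ 2) (h : IsSquare (-1 : F)) :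
    ¬ Function.Injective (Ind ℝ (SpecialLinearGroup.toGL : SL(2, F) →* GL (Fin 2) F)) := by
  classical
  have := Fintype.ofFinite F
  obtain ⟨a, ha⟩ := FiniteField.exists_nonsquare hF
  refine not_Ind_injective_of_trace_ne_zero ℝ ha fun ψ hψ => ?_
  set z := ∑ t, ψ t * ((unipotentConjCount t 1 : ℂ) - unipotentConjCount t a) with hz
  have hconj : (starRingEnd ℂ) z = z := by
    rw [hz, map_sum]
    refine Fintype.sum_equiv (Equiv.neg F) _ _ fun t => ?_
    rw [Equiv.neg_apply, unipotentConjCount_neg h, unipotentConjCount_neg h, map_mul, map_sub,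
      Complex.conj_natCast, Complex.conj_natCast, AddChar.map_neg_eq_conj]
  rw [Algebra.trace_complex_apply]
  refine mul_ne_zero two_ne_zero fun hre => hψ ?_
  rw [← Complex.conj_eq_iff_re.1 hconj, hre, Complex.ofReal_zero]

theorem exists_card_eq_two_pow_iff [Finite F] :
    (∃ n : ℕ, Nat.card F = 2 ^ n) ↔ ringChar F = 2 := by
  have := Fintype.ofFinite F
  rw [Nat.card_eq_fintype_card]
  constructor
  · rintro ⟨n, hn⟩
    rw [FiniteField.even_card_iff_char_two, hn]
    rcases n with _ | n
    · exact absurd hn Fintype.one_lt_card.ne'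
    · simp [pow_succ]
  · intro h
    have := ringChar.of_eq h
    obtain ⟨n, -, hn⟩ := FiniteField.card F 2
    exact ⟨n, hn⟩

end SLTwo

end

theorem mainTheorem3 {F : Type u} [Field F] [Finite F] (q : ℕ) (hq : Nat.card F = q) :
    (Function.Injective
        (RepGrp.Ind ℂ (Matrix.SpecialLinearGroup.toGL :
            Matrix.SpecialLinearGroup (Fin 2) F →* Matrix.GeneralLinearGroup (Fin 2) F) :
          RepGrp.R (Matrix.SpecialLinearGroup (Fin 2) F) →+
            RepGrp.R (Matrix.GeneralLinearGroup (Fin 2) F)) ↔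
      ∃ n : ℕ, q = 2 ^ n) ∧
    (Function.Injective
        (RepGrp.Ind ℝ (Matrix.SpecialLinearGroup.toGL :
            Matrix.SpecialLinearGroup (Fin 2) F →* Matrix.GeneralLinearGroup (Fin 2) F) :
          RepGrp.RO (Matrix.SpecialLinearGroup (Fin 2) F) →+
            RepGrp.RO (Matrix.GeneralLinearGroup (Fin 2) F)) ↔
      (∃ n : ℕ, q = 2 ^ n) ∨ q ≡ 3 [MOD 4]) := by
  have := Fintype.ofFinite F
  subst hq
  rw [SLTwo.exists_card_eq_two_pow_iff]
  have hneg : Nat.card F ≡ 3 [MOD 4] ↔ ¬ IsSquare (-1 : F) := by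
    rw [FiniteField.isSquare_neg_one_iff, not_not, Nat.card_eq_fintype_card]
    rfl
  rw [hneg]
  refine ⟨⟨fun h => ?_, fun h => ?_⟩, ⟨fun h => ?_, ?_⟩⟩
  · by_contra hF
    exact SLTwo.not_Ind_complex_injective hF h
  · exact SLTwo.Ind_injective_of_forall_isSquare (FiniteField.isSquare_of_char_two h)
  · by_contra! hF
    exact SLTwo.not_Ind_real_injective hF.1 hF.2 h
  · rintro (h | h)
    · exact SLTwo.Ind_injective_of_forall_isSquare (FiniteField.isSquare_of_char_two h)
    · exact SLTwo.Ind_real_injective_of_not_isSquare_neg_one h
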